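/- Let $n$ be a positive integer and let $\mathbb{Z}_n$ be the cyclic group of order $n$, written additively. For a positive integer $h$ and $A \subseteq \mathbb{Z}_n$, let $hA$ denote the set of all sums of $h$ (not necessarily distinct) elements of $A$. Call $A$ $(3,1)$-sum-free if $3A \cap 1A = \emptyset$, that is, if no sum of three (not necessarily distinct) elements of $A$ belongs to $A$, and let $\lambda_{3,1}(\mathbb{Z}_n)$ be the maximum size of a $(3,1)$-sum-free subset of $\mathbb{Z}_n$. Then $$\lambda_{3,1}(\mathbb{Z}_n)=\max_{\substack{d \mid n \\ d \not\equiv 2 \ (\mathrm{mod}\ 4)}} \left\{ \left\lfloor \frac{d+2}{4} \right\rfloor \cdot \frac{n}{d} \right\},$$ where $d$ runs over the positive divisors of $n$. Moreover, if $n$ is divisible by a prime congruent to $3$ modulo $4$ and $p$ is the smallest such prime, then $$\lambda_{3,1}(\mathbb{Z}_n) = \frac{p+1}{p}\cdot\frac{n}{4};$$ otherwise $\lambda_{3,1}(\mathbb{Z}_n) = \lfloor n/4 \rfloor$. -/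

import Mathlib

/-- The `h`-fold sumset `hA`: all sums of `h` (not necessarily distinct) elements of `A`. -/
def hFoldSumset {G : Type*} [AddCommGroup G] (h : ℕ) (A : Finset G) : Set G :=
  {x | ∃ f : Fin h → G, (∀ i, f i ∈ A) ∧ ∑ i, f i = x}

/-- `A` is `(k, l)`-sum-free: `kA ∩ lA = ∅`. -/
def IsKLSumFree {G : Type*} [AddCommGroup G] (k l : ℕ) (A : Finset G) : Prop :=
  hFoldSumset k A ∩ hFoldSumset l A = ∅

open Classical in
/-- `λ_{k,l}(G)`: the maximum size of a `(k, l)`-sum-free subset of the finite abelian group `G`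
(for positive `k` and `l` the empty set is `(k, l)`-sum-free, so this is a maximum over a
nonempty finite family). -/
noncomputable def maxKLSumFree (k l : ℕ) (G : Type*) [AddCommGroup G] [Fintype G] : ℕ :=
  ((Finset.univ : Finset (Finset G)).filter (fun A => IsKLSumFree k l A)).sup Finset.card

/-! Upper bound, for any finite abelian group, by strong induction on its order: Mann's theorem
gives a subgroup `H` with `|X + A| ≥ |X| + |H + A| - |H|` whenever `X + A` is not everything. Let
`S` be the image of `A` in `G ⧸ H`, with `u = |S|`, `d = |G ⧸ H|`, `h = |H|`. Since `3A` misses `A`,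
applying this to `X = A` and `X = A + A` gives `2|A| + 2uh ≤ (d + 2)h`; if `4|A| > n`, this and `|A|
≤ uh` leave only `d = 4u - 1`, `4u - 2`, `4u - 3`.

If `d = 4u - 1`, the divisor `q = d` gives the bound. If `d = 4u - 2`, all fibres exceed `h / 2`, so
`S` avoids triple sums; `AvoidsTripleSums.even_card` makes `u` even, and `q = d / 2` is `3` modulo
`4`. If `d = 4u - 3`, a solution of `i + j + l = w` in `S` exists, but any two distinct fibres are
too large to take part; so `i = j = l = w = 0`, and induction applies to the fibre in `H`.

Lower bound: a centred interval of residues modulo `d`, pulled back to `ZMod n`. -/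

open Finset
open scoped Pointwise

/-! ### Mann's theorem -/

/-- Submodularity of `X ↦ |X + S|`. -/
theorem card_inter_add_add_card_union_add_le {G : Type*} [AddCommGroup G] [DecidableEq G]
    (X Y S : Finset G) :
    #((X ∩ Y) + S) + #((X ∪ Y) + S) ≤ #(X + S) + #(Y + S) := by
  have h1 : (X ∩ Y) + S ⊆ (X + S) ∩ (Y + S) := Finset.inter_add_subset
  have h2 : (X ∪ Y) + S = (X + S) ∪ (Y + S) := Finset.union_add
  have h3 := card_le_card h1
  have h4 := card_union_add_card_inter (X + S) (Y + S)
  rw [h2]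
  omega

/-- **Mann's theorem**: the minimum of `|X + S| - |X|` over the nonempty `X` with `X + S ≠ G`
is attained at a subgroup. -/
theorem exists_addSubgroup_card_add_le {G : Type*} [AddCommGroup G] [Fintype G] [DecidableEq G]
    {S : Finset G} (hS : S.Nonempty) (hS' : S ≠ univ) :
    ∃ (H : AddSubgroup G) (K : Finset G), (K : Set G) = H ∧ K + S ≠ univ ∧
      ∀ X : Finset G, X.Nonempty → X + S ≠ univ → #X + #(K + S) ≤ #(X + S) + #K := by
  classical
  have le_add : ∀ X : Finset G, #X ≤ #(X + S) := fun X => card_le_card_add_right hS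
  -- The lexicographic order picks an atom: least expansion, then least size.
  obtain ⟨X₀, hX₀, hmin⟩ := Finset.exists_min_image
    (univ.filter fun X : Finset G => X.Nonempty ∧ X + S ≠ univ)
    (fun X => toLex (#(X + S) - #X, #X)) ⟨0, by simpa using hS'⟩
  simp only [mem_filter, mem_univ, true_and] at hX₀ hmin
  obtain ⟨hne, hun⟩ := hX₀
  have hκ : ∀ X : Finset G, X.Nonempty → X + S ≠ univ → #X + #(X₀ + S) ≤ #(X + S) + #X₀ := by
    intro X h1 h2
    have h3 := hmin X ⟨h1, h2⟩
    rw [Prod.Lex.toLex_le_toLex] at h3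
    have := le_add X; have := le_add X₀
    rcases h3 with h3 | h3 <;> simp only at h3 <;> omega
  have hatom : ∀ X : Finset G, X.Nonempty → X + S ≠ univ →
      #(X + S) + #X₀ ≤ #X + #(X₀ + S) → #X₀ ≤ #X := by
    intro X h1 h2 h4
    have h3 := hmin X ⟨h1, h2⟩
    rw [Prod.Lex.toLex_le_toLex] at h3
    have := le_add X; have := le_add X₀
    rcases h3 with h3 | h3 <;> simp only at h3 <;> omega
  -- the dual fragment
  have hdual : #X₀ + #(X₀ + S) ≤ Fintype.card G := by
    have hdisj : Disjoint (-(-(X₀ + S)ᶜ + S)) X₀ := by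
      rw [Finset.disjoint_left]
      intro x hx hx0
      rw [mem_neg] at hx
      obtain ⟨y, hy, rfl⟩ := hx
      obtain ⟨z, hz, s, hs, rfl⟩ := mem_add.1 hy
      obtain ⟨w, hw, rfl⟩ := mem_neg.1 hz
      rw [mem_compl] at hw
      exact hw (mem_add.2 ⟨_, hx0, s, hs, by abel⟩)
    have h5 : #(-(X₀ + S)ᶜ + S) + #X₀ ≤ Fintype.card G := by
      have := card_le_univ ((-(-(X₀ + S)ᶜ + S)) ∪ X₀)
      rwa [card_union_of_disjoint hdisj, card_neg] at this
    have h6 : #(-(X₀ + S)ᶜ) = Fintype.card G - #(X₀ + S) := by rw [card_neg, card_compl]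
    have h7 := card_le_univ (X₀ + S)
    have hpos := hne.card_pos
    have hn : (-(X₀ + S)ᶜ).Nonempty := by
      rw [neg_nonempty_iff, nonempty_iff_ne_empty, Ne, compl_eq_empty_iff]; exact hun
    have := hatom _ hn (by intro h; rw [h, card_univ] at h5; omega) (by omega)
    omega
  -- By submodularity the intersection also has least expansion, so it is all of the atom. `hdual`
  -- keeps the union plus `S` away from `univ`.
  have htrans : ∀ x : G, (X₀ ∩ (x +ᵥ X₀)).Nonempty → x +ᵥ X₀ = X₀ := by
    intro x hx
    have hsub := card_inter_add_add_card_union_add_le X₀ (x +ᵥ X₀) S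
    have h1 : #((x +ᵥ X₀) + S) = #(X₀ + S) := by rw [vadd_add_assoc, card_vadd_finset]
    have h2 := card_union_add_card_inter X₀ (x +ᵥ X₀)
    rw [card_vadd_finset] at h2
    have h3 : (X₀ ∩ (x +ᵥ X₀)) + S ≠ univ := by
      intro h
      apply hun
      rw [eq_univ_iff_forall] at h ⊢
      exact fun g => add_subset_add_right inter_subset_left (h g)
    have h4 := hκ _ hx h3
    have h5 := hx.card_pos
    have h6 : (X₀ ∪ (x +ᵥ X₀)) + S ≠ univ := by
      intro h; rw [h, card_univ] at hsub; omega
    have h7 := hκ _ (hne.mono subset_union_left) h6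
    have h8 := hatom _ hx h3 (by omega)
    have h9 := eq_of_subset_of_card_le (inter_subset_left (s₁ := X₀) (s₂ := x +ᵥ X₀)) h8
    exact (eq_of_subset_of_card_le (inter_eq_left.1 h9) (by rw [card_vadd_finset])).symm
  obtain ⟨x₀, hx₀⟩ := hne
  have hmem : ∀ g : G, g ∈ -x₀ +ᵥ X₀ ↔ g +ᵥ X₀ = X₀ := by
    intro g
    have : g ∈ -x₀ +ᵥ X₀ ↔ g + x₀ ∈ X₀ := by
      rw [mem_vadd_finset]
      constructor
      · rintro ⟨y, hy, rfl⟩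
        simpa [vadd_eq_add] using hy
      · intro h; exact ⟨_, h, by simp [vadd_eq_add]⟩
    rw [this]
    constructor
    · intro h
      exact htrans g ⟨g + x₀, mem_inter.2 ⟨h, mem_vadd_finset.2 ⟨x₀, hx₀, rfl⟩⟩⟩
    · intro h
      rw [← h]; exact mem_vadd_finset.2 ⟨x₀, hx₀, rfl⟩
  have hadd : (-x₀ +ᵥ X₀) + S = -x₀ +ᵥ (X₀ + S) := vadd_add_assoc _ _ _
  refine ⟨AddAction.stabilizer G X₀, -x₀ +ᵥ X₀, ?_, ?_, ?_⟩
  · ext g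
    rw [mem_coe, hmem]; rfl
  · rw [hadd]
    intro h
    apply hun
    apply eq_univ_of_card
    rw [← card_vadd_finset (-x₀), h, card_univ]
  · intro X h1 h2
    rw [hadd, card_vadd_finset, card_vadd_finset]
    exact hκ X h1 h2

/-- No sum of three elements of `A` lies in `A`. -/
def AvoidsTripleSums {G : Type*} [AddCommGroup G] (A : Finset G) : Prop :=
  ∀ x ∈ A, ∀ y ∈ A, ∀ z ∈ A, x + y + z ∉ A

theorem exists_mem_inter_of_card_lt {α : Type*} [DecidableEq α] {U B C : Finset α}
    (hB : B ⊆ U) (hC : C ⊆ U) (h : #U < #B + #C) : ∃ x ∈ B, x ∈ C := by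
  obtain ⟨x, hx⟩ := inter_nonempty_of_card_lt_card_add_card hB hC h
  exact ⟨x, mem_inter.1 hx⟩

/-! ### Groups of order 2 modulo 4 and the parity of `S` -/

section TwoTorsion

variable {Q : Type*} [AddCommGroup Q] [Fintype Q]

/-- The quotient by `⟨σ⟩` has odd order, so it has no two-torsion; a half of `σ` would have order 4,
which does not divide `|Q|`. -/
theorem exists_involution_of_card_mod_four_eq_two (hQ : Fintype.card Q % 4 = 2) :
    ∃ σ : Q, σ ≠ 0 ∧ σ + σ = 0 ∧ (∀ x : Q, x + x = 0 → x = 0 ∨ x = σ) ∧ ∀ x : Q, x + x ≠ σ := by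
  classical
  have : Fact (Nat.Prime 2) := ⟨Nat.prime_two⟩
  obtain ⟨σ, hσ⟩ := exists_prime_addOrderOf_dvd_card (G := Q) 2 (by omega)
  have hσ0 : σ ≠ 0 := by rintro rfl; simp at hσ
  have hσ2 : σ + σ = 0 := by
    have := addOrderOf_nsmul_eq_zero σ
    rwa [hσ, two_nsmul] at this
  refine ⟨σ, hσ0, hσ2, fun x hx => ?_, fun x hx => ?_⟩
  · have hc := AddSubgroup.card_eq_card_quotient_mul_card_addSubgroup (AddSubgroup.zmultiples σ)
    rw [Nat.card_zmultiples, hσ, Nat.card_eq_fintype_card] at hc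
    have h1 : addOrderOf (x : Q ⧸ AddSubgroup.zmultiples σ) ∣ 2 := by
      apply addOrderOf_dvd_of_nsmul_eq_zero
      rw [← QuotientAddGroup.mk_nsmul, two_nsmul, hx, QuotientAddGroup.mk_zero]
    have h2 := addOrderOf_dvd_natCard (x : Q ⧸ AddSubgroup.zmultiples σ)
    have h3 : addOrderOf (x : Q ⧸ AddSubgroup.zmultiples σ) = 1 := by
      rcases (Nat.dvd_prime Nat.prime_two).1 h1 with h | h
      · exact h
      · rw [h] at h2; omega
    rw [AddMonoid.addOrderOf_eq_one_iff, QuotientAddGroup.eq_zero_iff,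
      AddSubgroup.mem_zmultiples_iff] at h3
    obtain ⟨k, rfl⟩ := h3
    rcases Int.even_or_odd' k with ⟨j, rfl | rfl⟩
    · left; rw [mul_comm, mul_zsmul, two_zsmul, hσ2, zsmul_zero]
    · right; rw [add_zsmul, mul_comm, mul_zsmul, two_zsmul, hσ2, zsmul_zero, one_zsmul, zero_add]
  · have h4 : addOrderOf x = 2 ^ (1 + 1) := by
      apply addOrderOf_eq_prime_pow
      · rw [pow_one, two_nsmul, hx]; exact hσ0
      · rw [show 2 ^ (1 + 1) = 2 * 2 from rfl, mul_nsmul, two_nsmul, two_nsmul, hx, hσ2]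
    have := addOrderOf_dvd_card (x := x)
    rw [h4] at this
    omega

end TwoTorsion

theorem even_card_of_involution {α : Type*} (P : Finset α) (f : α → α) (hf : ∀ x ∈ P, f x ∈ P)
    (hff : ∀ x ∈ P, f (f x) = x) (hne : ∀ x ∈ P, f x ≠ x) : Even #P := by
  have : ∑ x ∈ P, (1 : ZMod 2) = 0 :=
    Finset.sum_involution (fun x _ => f x) (fun _ _ => by decide) (fun x hx _ => hne x hx)
      (fun x hx => hf x hx) (fun x hx => hff x hx)
  rw [sum_const, nsmul_one, ZMod.natCast_eq_zero_iff] at this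
  exact even_iff_two_dvd.2 this

/-- In a group of order `4 |S| - 2`, a set `S` that avoids its triple sums and does not expand
less than an arithmetic progression has even size: it is invariant under `x ↦ σ - x`, where `σ`
is the element of order two. -/
theorem AvoidsTripleSums.even_card {Q : Type*} [AddCommGroup Q] [Fintype Q] [DecidableEq Q]
    {S : Finset Q} (hS : AvoidsTripleSums S) (hcard : Fintype.card Q + 2 = 4 * #S)
    (hκ : ∀ Y : Finset Q, Y.Nonempty → Y + S ≠ univ → #Y + #S ≤ #(Y + S) + 1) : Even #S := by
  obtain ⟨σ, hσ0, hσ2, hσu, hσd⟩ := exists_involution_of_card_mod_four_eq_two (Q := Q) (by omega)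
  have hpos : 0 < #S := by omega
  obtain ⟨s₀, hs₀⟩ := card_pos.1 hpos
  set P := -S + S with hP
  set N := S + S with hN
  have hPmem : ∀ x ∈ S, ∀ y ∈ S, x - y ∈ P := fun x hx y hy =>
    mem_add.2 ⟨-y, neg_mem_neg hy, x, hx, by abel⟩
  have hNmem : ∀ x ∈ S, ∀ y ∈ S, x + y ∈ N := fun x hx y hy => add_mem_add hx hy
  have hPex : ∀ t ∈ P, ∃ x ∈ S, ∃ y ∈ S, t = x - y := by
    intro t ht
    obtain ⟨a, ha, x, hx, rfl⟩ := mem_add.1 ht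
    obtain ⟨y, hy, rfl⟩ := mem_neg.1 ha
    exact ⟨x, hx, y, hy, by abel⟩
  have hdisj : Disjoint P N := by
    rw [Finset.disjoint_left]
    intro t ht htN
    obtain ⟨x, hx, y, hy, rfl⟩ := hPex t ht
    obtain ⟨z, hz, w, hw, h⟩ := mem_add.1 htN
    apply hS z hz w hw y hy
    rw [h, sub_add_cancel]; exact hx
  have h0P : (0 : Q) ∈ P := by simpa using hPmem _ hs₀ _ hs₀
  have hPN : #P + #N ≤ Fintype.card Q := by
    rw [← card_union_of_disjoint hdisj]; exact card_le_univ _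
  have hNlow : 2 * #S ≤ #N + 1 := by
    have := hκ S ⟨s₀, hs₀⟩ (by
      intro h
      have : (0 : Q) ∈ N := by rw [hN, h]; exact mem_univ _
      exact Finset.disjoint_left.1 hdisj h0P this)
    rw [← hN] at this
    omega
  have hPlow : 2 * #S ≤ #P + 1 := by
    have := hκ (-S) ⟨-s₀, neg_mem_neg hs₀⟩ (by
      intro h
      have : s₀ + s₀ ∈ P := by rw [hP, h]; exact mem_univ _
      exact Finset.disjoint_left.1 hdisj this (hNmem _ hs₀ _ hs₀))
    rw [card_neg, ← hP] at this
    omega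
  have hPneg : ∀ t ∈ P, -t ∈ P := by
    intro t ht
    obtain ⟨x, hx, y, hy, rfl⟩ := hPex t ht
    rw [neg_sub]; exact hPmem _ hy _ hx
  have hσneg : -σ = σ := neg_eq_of_add_eq_zero_left hσ2
  -- The size bounds force `|P| = 2|S| - 1`, which is odd; with both `0` and `σ` in `P`, negation
  -- would pair off the rest.
  have hσP : σ ∉ P := by
    intro h
    have hev : Even #((P.erase 0).erase σ) := by
      apply even_card_of_involution _ (fun x => -x)
      · intro x hx
        simp only [mem_erase] at hx ⊢
        refine ⟨fun h' => hx.1 ?_, fun h' => hx.2.1 (neg_eq_zero.1 h'), hPneg _ hx.2.2⟩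
        rw [← hσneg, ← h', neg_neg]
      · intro x _; exact neg_neg x
      · intro x hx h'
        simp only [mem_erase] at hx
        rcases hσu x (by nth_rewrite 1 [← h']; exact neg_add_cancel x) with h1 | h1
        · exact hx.2.1 h1
        · exact hx.1 h1
    rw [card_erase_of_mem (mem_erase.2 ⟨hσ0, h⟩), card_erase_of_mem h0P] at hev
    obtain ⟨r, hr⟩ := hev
    have : 1 < #P := one_lt_card.2 ⟨0, h0P, σ, h, hσ0.symm⟩
    omega
  -- `S` and its translate by `σ`
  set T := S ∪ S.image (· + σ) with hT
  have hTcard : #T = 2 * #S := by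
    rw [hT, card_union_of_disjoint, card_image_of_injective _ (add_left_injective σ)]
    · omega
    · rw [Finset.disjoint_left]
      intro x hx hx'
      obtain ⟨y, hy, rfl⟩ := mem_image.1 hx'
      apply hσP
      simpa using hPmem _ hx _ hy
  have hTex : ∀ t ∈ T, ∃ s ∈ S, t = s ∨ t = s + σ := by
    intro t ht
    rcases mem_union.1 ht with h | h
    · exact ⟨t, h, Or.inl rfl⟩
    · obtain ⟨y, hy, rfl⟩ := mem_image.1 h
      exact ⟨y, hy, Or.inr rfl⟩
  -- `T` fills more than half of `Q`, so every element is a difference, and likewise a sum, of two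
  -- elements of `T`.
  have hPor : ∀ t : Q, t ∈ P ∨ t + σ ∈ P := by
    intro t
    obtain ⟨x, hx, hx'⟩ := exists_mem_inter_of_card_lt (U := univ) (B := T)
      (C := T.image (· + t)) (subset_univ _) (subset_univ _) (by
        rw [card_image_of_injective _ (add_left_injective t), card_univ]; omega)
    obtain ⟨y, hy, rfl⟩ := mem_image.1 hx'
    obtain ⟨a, ha, h1⟩ := hTex _ hx
    obtain ⟨b, hb, h2⟩ := hTex _ hy
    have hab := hPmem a ha b hb
    rcases h1 with h1 | h1 <;> rcases h2 with h2 | h2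
    · left; rwa [show t = a - b by rw [← h1, h2]; abel]
    · right; rwa [show t + σ = a - b by rw [← h1, h2]; abel]
    · right; rwa [show t + σ = a - b by rw [eq_sub_of_add_eq h1.symm, h2, sub_eq_add_neg _ σ, hσneg]; abel]
    · left; rwa [show t = a - b by rw [eq_sub_of_add_eq h1.symm, h2]; abel]
  have hNor : ∀ t : Q, t ∈ N ∨ t + σ ∈ N := by
    intro t
    obtain ⟨x, hx, hx'⟩ := exists_mem_inter_of_card_lt (U := univ) (B := T)
      (C := T.image (t - ·)) (subset_univ _) (subset_univ _) (by
        rw [card_image_of_injective _ sub_right_injective, card_univ]; omega)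
    obtain ⟨y, hy, rfl⟩ := mem_image.1 hx'
    obtain ⟨a, ha, h1⟩ := hTex _ hx
    obtain ⟨b, hb, h2⟩ := hTex _ hy
    have hab := hNmem a ha b hb
    have h3 : t = (t - y) + y := by abel
    rcases h1 with h1 | h1 <;> rcases h2 with h2 | h2
    · left; rwa [h3, h1, h2]
    · right; rwa [h3, h1, h2, show a + (b + σ) + σ = a + b + (σ + σ) by abel, hσ2, add_zero]
    · right; rwa [h3, h1, h2, show a + σ + b + σ = a + b + (σ + σ) by abel, hσ2, add_zero]
    · left; rwa [h3, h1, h2, show a + σ + (b + σ) = a + b + (σ + σ) by abel, hσ2, add_zero]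
  have hσσ : ∀ t : Q, t + σ + σ = t := fun t => by rw [add_assoc, hσ2, add_zero]
  have hNP : ∀ t : Q, t ∈ N → t + σ ∈ P := fun t ht =>
    (hPor t).resolve_left fun h => Finset.disjoint_left.1 hdisj h ht
  have hPN' : ∀ t : Q, t ∈ P → t + σ ∈ N := fun t ht =>
    (hNor t).resolve_left fun h => Finset.disjoint_left.1 hdisj ht h
  have hNneg : ∀ t ∈ N, -t ∈ N := by
    intro t ht
    have := hPN' _ (hPneg _ (hNP t ht))
    rwa [neg_add, hσneg, hσσ] at this
  -- maximality of `S`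
  have hmax : ∀ x : Q, (∀ a ∈ S, ∀ b ∈ S, ∀ c ∈ S, a + b + c ≠ x) → x ∈ S := by
    intro x hx
    have h3 : N + S ≠ univ := by
      intro h
      obtain ⟨ab, hab, c, hc, h⟩ := mem_add.1 (h ▸ mem_univ x)
      obtain ⟨a, ha, b, hb, rfl⟩ := mem_add.1 hab
      exact hx a ha b hb c hc h
    have h4 := hκ N ⟨_, hNmem _ hs₀ _ hs₀⟩ h3
    have h5 : S = (N + S)ᶜ := by
      apply eq_of_subset_of_card_le
      · intro y hy
        rw [mem_compl]
        intro h
        obtain ⟨ab, hab, c, hc, h⟩ := mem_add.1 h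
        obtain ⟨a, ha, b, hb, rfl⟩ := mem_add.1 hab
        exact hS a ha b hb c hc (h ▸ hy)
      · rw [card_compl]; omega
    rw [h5, mem_compl]
    intro h
    obtain ⟨ab, hab, c, hc, h⟩ := mem_add.1 h
    obtain ⟨a, ha, b, hb, rfl⟩ := mem_add.1 hab
    exact hx a ha b hb c hc h
  apply even_card_of_involution S (fun x => σ - x)
  · intro x hx
    apply hmax
    intro a ha b hb c hc h
    have h1 : a + b ∈ P := by
      have := hNP _ (hNneg _ (hNmem x hx c hc))
      rwa [show a + b = -(x + c) + σ by rw [eq_sub_of_add_eq h]; abel]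
    exact Finset.disjoint_left.1 hdisj h1 (hNmem a ha b hb)
  · intro x _; exact sub_sub_cancel σ x
  · intro x _ h
    exact hσd x (by nth_rewrite 1 [← h]; exact sub_add_cancel σ x)

/-! ### Fibres over a quotient -/

section Quotient

variable {G : Type*} [AddCommGroup G] [Fintype G] (H : AddSubgroup G) [DecidableEq (G ⧸ H)]

theorem card_filter_mk_mem (Y : Finset (G ⧸ H)) :
    #(univ.filter fun g : G => (g : G ⧸ H) ∈ Y) = Nat.card H * #Y := by
  have h := Nat.card_congr (QuotientAddGroup.preimageMkEquivAddSubgroupProdSet H (Y : Set (G ⧸ H)))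
  rw [Nat.card_prod] at h
  rw [Nat.card_coe_set_eq, Nat.card_coe_set_eq (Y : Set (G ⧸ H)), Set.ncard_coe_finset] at h
  rw [← h, ← Set.ncard_coe_finset]
  congr 1
  ext g
  simp

theorem card_filter_mk_eq (i : G ⧸ H) : #(univ.filter fun g : G => (g : G ⧸ H) = i) = Nat.card H := by
  simpa using card_filter_mk_mem H {i}

variable {H}

/-- Two subsets of cosets of `H` of total size more than `|H|` add up to a full coset. -/
theorem exists_add_eq_of_card_lt [DecidableEq G] {B C : Finset G} {i j : G ⧸ H}
    (hB : ∀ b ∈ B, (b : G ⧸ H) = i) (hC : ∀ c ∈ C, (c : G ⧸ H) = j)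
    (h : Nat.card H < #B + #C) {g : G} (hg : (g : G ⧸ H) = i + j) :
    ∃ b ∈ B, ∃ c ∈ C, b + c = g := by
  obtain ⟨x, hx, hx'⟩ := exists_mem_inter_of_card_lt (U := (univ.filter fun g : G => (g : G ⧸ H) = i)) (B := B)
    (C := C.image (g - ·)) (fun b hb => by simpa using hB b hb)
    (fun x hx => by
      obtain ⟨c, hc, rfl⟩ := mem_image.1 hx
      simp [hg, hC c hc])
    (by rwa [card_image_of_injective _ sub_right_injective, card_filter_mk_eq])
  obtain ⟨c, hc, rfl⟩ := mem_image.1 hx'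
  exact ⟨_, hx, c, hc, sub_add_cancel g c⟩

theorem card_filter_le (A : Finset G) (i : G ⧸ H) : #(A.filter fun g : G => (g : G ⧸ H) = i) ≤ Nat.card H := by
  rw [← card_filter_mk_eq H i]
  exact card_le_card (filter_subset_filter _ (subset_univ A))

/-- Each fibre outside `T` has at most `|H|` elements, so the fibres over `T` carry the rest of `A`.
-/
theorem card_add_le_sum_filter (A : Finset G) {T : Finset (G ⧸ H)}
    (hT : T ⊆ A.image ((↑) : G → G ⧸ H)) :
    #A + #T * Nat.card H ≤
      ∑ i ∈ T, #(A.filter fun g : G => (g : G ⧸ H) = i) + #(A.image ((↑) : G → G ⧸ H)) * Nat.card H := by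
  have h1 : #A = ∑ i ∈ A.image ((↑) : G → G ⧸ H), #(A.filter fun g : G => (g : G ⧸ H) = i) :=
    card_eq_sum_card_image _ _
  rw [← sum_sdiff hT] at h1
  have h2 : ∑ i ∈ A.image ((↑) : G → G ⧸ H) \ T, #(A.filter fun g : G => (g : G ⧸ H) = i) ≤
      #(A.image ((↑) : G → G ⧸ H) \ T) * Nat.card H := by
    rw [← smul_eq_mul]
    exact sum_le_card_nsmul _ _ _ fun i _ => card_filter_le A i
  have h3 := card_sdiff_add_card_eq_card hT
  have h4 : #(A.image ((↑) : G → G ⧸ H)) * Nat.card H =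
      #(A.image ((↑) : G → G ⧸ H) \ T) * Nat.card H + #T * Nat.card H := by
    rw [← h3, add_mul]
  omega

/-- Fibres that are jointly larger than a coset of `H` cannot be involved in a coset solution of
`i + j + l = w`. -/
theorem AvoidsTripleSums.add_add_ne [DecidableEq G] {A : Finset G} (hA : AvoidsTripleSums A)
    {i j l w : G ⧸ H} (hl : l ∈ A.image ((↑) : G → G ⧸ H)) (hw : w ∈ A.image ((↑) : G → G ⧸ H))
    (h : Nat.card H < #(A.filter fun g : G => (g : G ⧸ H) = i) + #(A.filter fun g : G => (g : G ⧸ H) = j)) :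
    i + j + l ≠ w := by
  intro e
  obtain ⟨c, hc, rfl⟩ := mem_image.1 hl
  obtain ⟨d, hd, rfl⟩ := mem_image.1 hw
  obtain ⟨a, ha, b, hb, hab⟩ := exists_add_eq_of_card_lt (g := d - c)
    (fun b hb => (mem_filter.1 hb).2) (fun b hb => (mem_filter.1 hb).2) h
    (by rw [QuotientAddGroup.mk_sub, ← e, add_sub_cancel_right])
  apply hA a (mem_filter.1 ha).1 b (mem_filter.1 hb).1 c hc
  rwa [hab, sub_add_cancel]

theorem AvoidsTripleSums.add_add_ne' [DecidableEq G] {A : Finset G} (hA : AvoidsTripleSums A)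
    {i j l w : G ⧸ H} (hi : i ∈ A.image ((↑) : G → G ⧸ H)) (hj : j ∈ A.image ((↑) : G → G ⧸ H))
    (h : Nat.card H < #(A.filter fun g : G => (g : G ⧸ H) = l) + #(A.filter fun g : G => (g : G ⧸ H) = w)) :
    i + j + l ≠ w := by
  intro e
  obtain ⟨a, ha, rfl⟩ := mem_image.1 hi
  obtain ⟨b, hb, rfl⟩ := mem_image.1 hj
  obtain ⟨d, hd, c, hc, hdc⟩ := exists_add_eq_of_card_lt (g := a + b)
    (B := (A.filter fun g : G => (g : G ⧸ H) = w)) (C := -(A.filter fun g : G => (g : G ⧸ H) = l)) (i := w) (j := -l)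
    (fun b hb => (mem_filter.1 hb).2)
    (fun c hc => by
      rw [mem_neg] at hc
      obtain ⟨c, hc, rfl⟩ := hc
      rw [QuotientAddGroup.mk_neg, (mem_filter.1 hc).2])
    (by rwa [card_neg, add_comm])
    (by rw [← e, QuotientAddGroup.mk_add, add_neg_cancel_right])
  rw [mem_neg] at hc
  obtain ⟨c, hc, rfl⟩ := hc
  apply hA a ha b hb c (mem_filter.1 hc).1
  rw [← hdc, neg_add_cancel_right]
  exact (mem_filter.1 hd).1

end Quotient

/-- Mann's inequality written in terms of the image of `A`; applied to unions of cosets and divided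
by `|H|`, it descends to the quotient. -/
theorem exists_quotient_expansion {G : Type*} [AddCommGroup G] [Fintype G] [DecidableEq G]
    {A : Finset G} (hA : A.Nonempty) (hA' : A ≠ univ) :
    ∃ H : AddSubgroup G, ∀ [DecidableEq (G ⧸ H)] [Fintype (G ⧸ H)],
      A.image ((↑) : G → G ⧸ H) ≠ univ ∧
      (∀ X : Finset G, X.Nonempty → X + A ≠ univ →
        #X + Nat.card H * #(A.image ((↑) : G → G ⧸ H)) ≤ #(X + A) + Nat.card H) ∧
      ∀ Y : Finset (G ⧸ H), Y.Nonempty → Y + A.image ((↑) : G → G ⧸ H) ≠ univ →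
        #Y + #(A.image ((↑) : G → G ⧸ H)) ≤ #(Y + A.image ((↑) : G → G ⧸ H)) + 1 := by
  obtain ⟨H, K, hK, hKA, hX⟩ := exists_addSubgroup_card_add_le hA hA'
  refine ⟨H, ?_⟩
  intro _ _
  have hKmem : ∀ x, x ∈ K ↔ x ∈ H := fun x => by rw [← mem_coe, hK]; rfl
  have hKcard : #K = Nat.card H := by
    rw [← Set.ncard_coe_finset, hK]; rfl
  have hsum : ∀ Y : Finset (G ⧸ H), (univ.filter fun g : G => (g : G ⧸ H) ∈ Y) + A =
      (univ.filter fun g : G => (g : G ⧸ H) ∈ Y + A.image ((↑) : G → G ⧸ H)) := by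
    intro Y
    ext g
    simp only [mem_add, mem_filter, mem_univ, true_and, mem_image]
    constructor
    · rintro ⟨y, hy, a, ha, rfl⟩
      exact ⟨_, hy, _, ⟨a, ha, rfl⟩, rfl⟩
    · rintro ⟨y, hy, _, ⟨a, ha, rfl⟩, h⟩
      refine ⟨g - a, ?_, a, ha, sub_add_cancel g a⟩
      rwa [QuotientAddGroup.mk_sub, ← h, add_sub_cancel_right]
  have hK0 : K = (univ.filter fun g : G => (g : G ⧸ H) ∈ ({0} : Finset (G ⧸ H))) := by
    ext g
    simp [hKmem]
  have hne : ∀ Y : Finset (G ⧸ H), Y ≠ univ ↔ (univ.filter fun g : G => (g : G ⧸ H) ∈ Y) ≠ univ := by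
    intro Y
    rw [not_iff_not]
    simp only [eq_univ_iff_forall, mem_filter, mem_univ, true_and]
    exact ⟨fun h g => h g, fun h q => QuotientAddGroup.induction_on q h⟩
  have hKA' : K + A = (univ.filter fun g : G => (g : G ⧸ H) ∈ A.image ((↑) : G → G ⧸ H)) := by
    rw [hK0, hsum, singleton_zero, zero_add]
  have hpos : 0 < Nat.card H := Nat.card_pos
  refine ⟨by rwa [hne, ← hKA'], fun X h1 h2 => ?_, fun Y h1 h2 => ?_⟩
  · have := hX X h1 h2
    rwa [hKA', card_filter_mk_mem, hKcard] at this
  · have := hX (univ.filter fun g : G => (g : G ⧸ H) ∈ Y) (by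
      obtain ⟨y, hy⟩ := h1
      induction y using QuotientAddGroup.induction_on with
      | H g => exact ⟨g, by simpa using hy⟩) (by rwa [hsum, ← hne])
    rw [hKA', hsum, card_filter_mk_mem, card_filter_mk_mem, card_filter_mk_mem, hKcard,
      ← mul_add, ← mul_add_one] at this
    exact Nat.le_of_mul_le_mul_left this hpos

theorem AvoidsTripleSums.card_filter_mk_eq_zero {G : Type*} [AddCommGroup G] [Fintype G]
    {H : AddSubgroup G} [DecidableEq (G ⧸ H)] {A : Finset G} (hA : AvoidsTripleSums A) :
    ∃ B : Finset H, AvoidsTripleSums B ∧ #B = #(A.filter fun g : G => (g : G ⧸ H) = 0) := by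
  classical
  refine ⟨univ.filter fun x : H => (x : G) ∈ A, ?_, ?_⟩
  · intro x hx y hy z hz hw
    simp only [mem_filter, mem_univ, true_and] at hx hy hz hw
    exact hA _ hx _ hy _ hz (by simpa using hw)
  · refine card_bij (fun x _ => (x : G)) (fun x hx => ?_) (fun x _ y _ h => Subtype.ext h)
      (fun g hg => ?_)
    · rw [mem_filter] at hx ⊢
      exact ⟨hx.2, (QuotientAddGroup.eq_zero_iff _).2 x.2⟩
    · rw [mem_filter] at hg
      exact ⟨⟨g, (QuotientAddGroup.eq_zero_iff _).1 hg.2⟩, by simpa using hg.1, rfl⟩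

/-- If `4 |S| > |Q| + 2` and `S` expands at least like an arithmetic progression, then some sum of three elements of `S` lies in `S`. -/
theorem exists_add_add_eq_of_expansion {Q : Type*} [AddCommGroup Q] [Fintype Q] [DecidableEq Q]
    {S : Finset Q} (hS : S.Nonempty) (hcard : Fintype.card Q + 2 < 4 * #S)
    (hκ : ∀ Y : Finset Q, Y.Nonempty → Y + S ≠ univ → #Y + #S ≤ #(Y + S) + 1) :
    ∃ i ∈ S, ∃ j ∈ S, ∃ l ∈ S, ∃ w ∈ S, i + j + l = w := by
  obtain ⟨s, hs⟩ := hS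
  suffices h : ∃ w ∈ S + S + S, w ∈ S by
    obtain ⟨w, hw, hwS⟩ := h
    obtain ⟨ij, hij, l, hl, rfl⟩ := mem_add.1 hw
    obtain ⟨i, hi, j, hj, rfl⟩ := mem_add.1 hij
    exact ⟨i, hi, j, hj, l, hl, _, hwS, rfl⟩
  by_cases h2 : S + S = univ
  · exact ⟨s, mem_add.2 ⟨0, h2 ▸ mem_univ _, s, hs, zero_add s⟩, hs⟩
  by_cases h3 : S + S + S = univ
  · exact ⟨s, h3 ▸ mem_univ _, hs⟩
  have h4 := hκ S ⟨s, hs⟩ h2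
  have h5 := hκ (S + S) ⟨_, add_mem_add hs hs⟩ h3
  exact exists_mem_inter_of_card_lt (subset_univ _) (subset_univ _) (by rw [card_univ]; omega)

/-! ### The upper bound -/

/-- The upper bound for sets avoiding their triple sums in a finite abelian group of order `n`. -/
theorem AvoidsTripleSums.card_le (n : ℕ) : ∀ (G : Type) [AddCommGroup G] [Fintype G],
    Fintype.card G = n → ∀ A : Finset G, AvoidsTripleSums A →
      4 * #A ≤ n ∨ ∃ q, q ∣ n ∧ q % 4 = 3 ∧ 4 * (q * #A) ≤ (q + 1) * n := by
  induction n using Nat.strong_induction_on with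
  | _ n ih =>
  intro G _ _ hn A hA
  classical
  by_contra! hcon
  obtain ⟨hbig, hq⟩ := hcon
  have hAne : A.Nonempty := card_pos.1 (by omega)
  obtain ⟨a, ha⟩ := hAne
  have hsum2 : A + A ≠ univ := by
    intro h
    obtain ⟨x, hx, y, hy, hxy⟩ := mem_add.1 (h ▸ mem_univ (0 : G))
    exact hA x hx y hy a ha (by rwa [hxy, zero_add])
  have hdisj : Disjoint (A + A + A) A := by
    rw [Finset.disjoint_left]
    intro t ht
    obtain ⟨xy, hxy, z, hz, rfl⟩ := mem_add.1 ht
    obtain ⟨x, hx, y, hy, rfl⟩ := mem_add.1 hxy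
    exact hA x hx y hy z hz
  have hsum3 : A + A + A ≠ univ := fun h =>
    Finset.disjoint_left.1 hdisj (h ▸ mem_univ a) ha
  have hAu : A ≠ univ := by rintro rfl; exact hA a ha a ha a ha (mem_univ _)
  obtain ⟨H, hH⟩ := exists_quotient_expansion ⟨a, ha⟩ hAu
  obtain ⟨hSu, hX, hY⟩ := hH
  set S := A.image ((↑) : G → G ⧸ H) with hSdef
  have hSne : S.Nonempty := ⟨_, mem_image_of_mem _ ha⟩
  set u := #S with hu
  set h := Nat.card H with hh
  set d := Fintype.card (G ⧸ H) with hd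
  have hpos : 0 < h := Nat.card_pos
  have hndh : n = d * h := by
    rw [← hn, ← Nat.card_eq_fintype_card,
      AddSubgroup.card_eq_card_quotient_mul_card_addSubgroup H, Nat.card_eq_fintype_card]
  have hud : u < d := by
    rw [hu, hd, ← card_univ]
    exact card_lt_card (ssubset_univ_iff.2 hSu)
  have hfib : ∀ T ⊆ S, #A + #T * h ≤ ∑ i ∈ T, #(A.filter fun g : G => (g : G ⧸ H) = i) + u * h :=
    fun T hT => card_add_le_sum_filter A hT
  have hAuh : #A ≤ u * h := by simpa using hfib ∅ (empty_subset _)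
  have hfib1 : ∀ i ∈ S, #A + h ≤ #(A.filter fun g : G => (g : G ⧸ H) = i) + u * h := by
    intro i hi
    simpa using hfib {i} (singleton_subset_iff.2 hi)
  have hfib2 : ∀ i ∈ S, ∀ j ∈ S, i ≠ j → #A + 2 * h ≤ #(A.filter fun g : G => (g : G ⧸ H) = i) +
      #(A.filter fun g : G => (g : G ⧸ H) = j) + u * h := by
    intro i hi j hj hij
    have := hfib {i, j} (by intro x; simp only [mem_insert, mem_singleton]; rintro (rfl | rfl) <;> assumption)
    rwa [sum_pair hij, card_pair hij] at this
  have hexp : 2 * #A + 2 * (u * h) ≤ d * h + 2 * h := by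
    have h1 := hX A ⟨a, ha⟩ hsum2
    have h2 := hX (A + A) ⟨_, add_mem_add ha ha⟩ hsum3
    have h3 := card_le_univ ((A + A + A) ∪ A)
    rw [card_union_of_disjoint hdisj, hn, hndh] at h3
    rw [mul_comm h u] at h1 h2
    omega
  have hl1 : d < 4 * u := by
    apply Nat.lt_of_mul_lt_mul_right (a := h)
    rw [mul_assoc]; omega
  have hl2 : 4 * u < d + 4 := by
    apply Nat.lt_of_mul_lt_mul_right (a := h)
    rw [mul_assoc, add_mul]; omega
  obtain hc | hc | hc : d + 1 = 4 * u ∨ d + 2 = 4 * u ∨ d + 3 = 4 * u := by omega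
  · have h1 := hq d ⟨h, hndh⟩ (by omega)
    have h2 := Nat.mul_le_mul_left (4 * d) hAuh
    rw [hndh, hc] at h1
    linarith
  · have hc' : d * h + 2 * h = 4 * (u * h) := by rw [← add_mul, hc, mul_assoc]
    have hhalf : ∀ i ∈ S, h < 2 * #(A.filter fun g : G => (g : G ⧸ H) = i) := by
      intro i hi
      have := hfib1 i hi
      omega
    have hS : AvoidsTripleSums S := by
      intro i hi j hj l hl hw
      refine hA.add_add_ne (H := H) (i := i) (j := j) hl hw ?_ rfl
      have := hhalf i hi
      have := hhalf j hj
      omega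
    obtain ⟨r, hr⟩ := hS.even_card hc hY
    have h1 := hq (4 * r - 1) ⟨2 * h, by rw [hndh, show d = (4 * r - 1) * 2 by omega, mul_assoc]⟩
      (by omega)
    have h2 := Nat.mul_le_mul_left (4 * (4 * r - 1)) hAuh
    rw [hndh, show d = (4 * r - 1) * 2 by omega, show 4 * r - 1 + 1 = 4 * r by omega] at h1
    rw [show u = 2 * r by omega] at h2
    linarith
  · have hc' : d * h + 3 * h = 4 * (u * h) := by rw [← add_mul, hc, mul_assoc]
    obtain ⟨i, hi, j, hj, l, hl, w, hw, he⟩ := exists_add_add_eq_of_expansion hSne (by omega) hY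
    have hpair : ∀ i ∈ S, ∀ j ∈ S, i ≠ j → h < #(A.filter fun g : G => (g : G ⧸ H) = i) +
        #(A.filter fun g : G => (g : G ⧸ H) = j) := by
      intro i hi j hj hij
      have := hfib2 i hi j hj hij
      omega
    -- Two distinct fibres together exceed `5h / 4`, so distinct entries of the solution would lift
    -- it to `A`.
    have hij : i = j := by
      by_contra hne
      exact hA.add_add_ne hl hw (hpair i hi j hj hne) he
    have hil : i = l := by
      by_contra hne
      exact hA.add_add_ne hj hw (hpair i hi l hl hne) (by rw [← he]; abel)
    have hlw : l = w := by
      by_contra hne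
      exact hA.add_add_ne' hi hj (hpair l hl w hw hne) he
    have hi2 : 2 • i = 0 := by
      rw [← hij, ← hlw, ← hil] at he
      rw [two_nsmul]
      exact add_eq_right.1 he
    -- `d = 4u - 3` is odd, so the quotient has no element of order two.
    have hi0 : i = 0 := by
      have h1 := addOrderOf_dvd_of_nsmul_eq_zero hi2
      rw [← AddMonoid.addOrderOf_eq_one_iff]
      rcases (Nat.dvd_prime Nat.prime_two).1 h1 with h2 | h2
      · exact h2
      · have h3 := addOrderOf_dvd_card (x := i)
        rw [h2] at h3
        omega
    obtain ⟨B, hB, hBcard⟩ := hA.card_filter_mk_eq_zero (H := H)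
    have hA0 := hfib1 i hi
    rw [hi0, ← hBcard] at hA0
    have hlt : h < n := by rw [hndh]; nlinarith
    rcases ih h hlt H (by rw [hh, Nat.card_eq_fintype_card]) B hB with h1 | ⟨q, hqh, hq3, h1⟩
    · omega
    · have h2 := hq q (by rw [hndh]; exact hqh.mul_left d) hq3
      obtain ⟨k, hk⟩ : ∃ k, u = k + 1 := ⟨u - 1, by omega⟩
      rw [hndh, show d = 4 * k + 1 by omega] at h2
      rw [hk] at hA0
      have h3 : #A ≤ #B + k * h := by linarith
      have h4 := Nat.mul_le_mul_left (4 * q) h3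
      nlinarith [Nat.zero_le (k * h)]

/-! ### The construction -/

theorem isKLSumFree_three_one_iff {G : Type*} [AddCommGroup G] (A : Finset G) :
    IsKLSumFree 3 1 A ↔ AvoidsTripleSums A := by
  unfold IsKLSumFree
  rw [Set.eq_empty_iff_forall_notMem]
  constructor
  · intro h x hx y hy z hz hw
    refine h (x + y + z) ⟨⟨![x, y, z], ?_, ?_⟩, ⟨![x + y + z], ?_, ?_⟩⟩
    · intro i; fin_cases i <;> simpa
    · simp [Fin.sum_univ_three]
    · intro i; fin_cases i; simpa
    · simp
  · rintro h x ⟨⟨f, hf, rfl⟩, ⟨g, hg, hgf⟩⟩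
    refine h _ (hf 0) _ (hf 1) _ (hf 2) ?_
    rw [← Fin.sum_univ_three f, ← hgf]
    simpa using hg 0

/-- A set of residues modulo `n` made of intervals of length `a` repeated with period `d`. -/
theorem exists_avoidsTripleSums (n : ℕ) [NeZero n] {d : ℕ} (hd : d ∣ n) (hd2 : d % 4 ≠ 2) :
    ∃ A : Finset (ZMod n), AvoidsTripleSums A ∧ #A = (d + 2) / 4 * (n / d) := by
  obtain ⟨m, rfl⟩ := hd
  have hn : d * m ≠ 0 := NeZero.ne _
  have hd0 : 0 < d := Nat.pos_of_ne_zero (left_ne_zero_of_mul hn)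
  have hm0 : 0 < m := Nat.pos_of_ne_zero (right_ne_zero_of_mul hn)
  set a := (d + 2) / 4 with ha
  -- This start places every difference (three terms minus a fourth) between `2x - a + 1 > 0` and
  -- `2x + 3a - 3 ≤ 4a - 2 ≤ d`. The last two bounds are both equalities only if `d ≡ 2 (mod 4)`,
  -- which is excluded.
  set x := (a + 1) / 2 with hx
  have hmem : ∀ {p : ℕ × ℕ}, p ∈ range a ×ˢ range m → p.1 < a ∧ p.2 < m := by
    intro p hp; simpa using hp
  refine ⟨(range a ×ˢ range m).image fun p => ((x + p.1 + d * p.2 : ℕ) : ZMod (d * m)), ?_, ?_⟩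
  · have key : ∀ v ∈ (range a ×ˢ range m).image
        (fun p => ((x + p.1 + d * p.2 : ℕ) : ZMod (d * m))),
        ∃ i < a, ZMod.castHom (Dvd.intro m rfl) (ZMod d) v = ((x + i : ℕ) : ZMod d) := by
      intro v hv
      obtain ⟨p, hp, rfl⟩ := mem_image.1 hv
      refine ⟨p.1, (hmem hp).1, ?_⟩
      rw [map_natCast]
      push_cast
      rw [ZMod.natCast_self]
      ring
    intro v₁ h₁ v₂ h₂ v₃ h₃ h₄
    obtain ⟨i₁, hi₁, e₁⟩ := key _ h₁
    obtain ⟨i₂, hi₂, e₂⟩ := key _ h₂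
    obtain ⟨i₃, hi₃, e₃⟩ := key _ h₃
    obtain ⟨i₄, hi₄, e₄⟩ := key _ h₄
    rw [map_add, map_add, e₁, e₂, e₃, ← Nat.cast_add, ← Nat.cast_add] at e₄
    rw [ZMod.natCast_eq_natCast_iff] at e₄
    have h5 := (Nat.modEq_iff_dvd' (by omega)).1 e₄.symm
    have h6 := Nat.le_of_dvd (by omega) h5
    omega
  · rw [card_image_of_injOn, card_product, card_range, card_range, Nat.mul_div_cancel_left m hd0]
    intro p hp p' hp' h
    obtain ⟨h1, h2⟩ := hmem (mem_coe.1 hp)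
    obtain ⟨h3, h4⟩ := hmem (mem_coe.1 hp')
    simp only at h
    rw [ZMod.natCast_eq_natCast_iff] at h
    have h5 : ∀ i j, i < a → j < m → (i + d * j) < d * m := by
      intro i j hi hj
      have : d * j + d ≤ d * m := by rw [← Nat.mul_succ]; exact Nat.mul_le_mul_left d hj
      omega
    rw [add_assoc, add_assoc] at h
    have h6 := Nat.ModEq.eq_of_lt_of_lt (Nat.ModEq.add_left_cancel' x h) (h5 _ _ h1 h2)
      (h5 _ _ h3 h4)
    have h7 : p.1 = p'.1 := by
      have := congrArg (· % d) h6
      simpa [Nat.mod_eq_of_lt (show p.1 < d by omega),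
        Nat.mod_eq_of_lt (show p'.1 < d by omega)] using this
    have h8 : p.2 = p'.2 := by
      rw [h7] at h6
      exact Nat.eq_of_mul_eq_mul_left hd0 (by omega)
    exact Prod.ext h7 h8

theorem le_maxKLSumFree {n : ℕ} [NeZero n] {d : ℕ} (hd : d ∣ n) (hd2 : d % 4 ≠ 2) :
    (d + 2) / 4 * (n / d) ≤ maxKLSumFree 3 1 (ZMod n) := by
  classical
  obtain ⟨A, hA, hAc⟩ := exists_avoidsTripleSums n hd hd2
  rw [← hAc]
  exact Finset.le_sup (f := card)
    (mem_filter.2 ⟨mem_univ _, (isKLSumFree_three_one_iff A).2 hA⟩)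

theorem maxKLSumFree_bound (n : ℕ) [NeZero n] :
    4 * maxKLSumFree 3 1 (ZMod n) ≤ n ∨
      ∃ q, q ∣ n ∧ q % 4 = 3 ∧ 4 * (q * maxKLSumFree 3 1 (ZMod n)) ≤ (q + 1) * n := by
  classical
  obtain ⟨A, hA, h⟩ := Finset.exists_mem_eq_sup
    ((Finset.univ : Finset (Finset (ZMod n))).filter (fun A => IsKLSumFree 3 1 A))
    ⟨∅, mem_filter.2 ⟨mem_univ _, (isKLSumFree_three_one_iff _).2 fun x hx => by simp at hx⟩⟩
    Finset.card
  have : maxKLSumFree 3 1 (ZMod n) = #A := by rw [← h]; unfold maxKLSumFree; congr!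
  rw [this]
  exact AvoidsTripleSums.card_le n (ZMod n) (ZMod.card n) A
    ((isKLSumFree_three_one_iff A).1 (mem_filter.1 hA).2)

/-! ### Divisor arithmetic and the final formulas -/

theorem exists_dvd_div_four_le (n : ℕ) [NeZero n] :
    ∃ d, d ∣ n ∧ d % 4 ≠ 2 ∧ n / 4 ≤ (d + 2) / 4 * (n / d) := by
  have hn : 0 < n := NeZero.pos n
  by_cases h : n % 4 = 2
  · refine ⟨n / 2, Nat.div_dvd_of_dvd (by omega), by omega, ?_⟩
    rw [Nat.div_div_self (by omega) hn.ne']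
    omega
  · exact ⟨n, dvd_rfl, h, by rw [Nat.div_self hn]; omega⟩

theorem exists_prime_dvd_of_mod_four_eq_three {q : ℕ} (hq : q % 4 = 3) :
    ∃ p, p.Prime ∧ p ∣ q ∧ p ≡ 3 [MOD 4] := by
  induction q using Nat.strong_induction_on with
  | _ q ih =>
  obtain ⟨p, hp, r, rfl⟩ := Nat.exists_prime_and_dvd (n := q) (by omega)
  have hr : 0 < r := by rcases Nat.eq_zero_or_pos r with rfl | h <;> omega
  by_cases hp3 : p % 4 = 3
  · exact ⟨p, hp, Dvd.intro r rfl, hp3⟩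
  · have hr3 : r % 4 = 3 := by
      rw [Nat.mul_mod] at hq
      have h1 := Nat.mod_lt p (show 4 > 0 by omega)
      have h2 := Nat.mod_lt r (show 4 > 0 by omega)
      interval_cases p % 4 <;> interval_cases r % 4 <;> omega
    obtain ⟨p', h1, h2, h3⟩ := ih r (by nlinarith [hp.two_le]) hr3
    exact ⟨p', h1, h2.mul_left p, h3⟩

theorem maxKLSumFree_eq_sup (n : ℕ) [NeZero n] :
    maxKLSumFree 3 1 (ZMod n) =
      (n.divisors.filter (fun d => ¬ d ≡ 2 [MOD 4])).sup (fun d => (d + 2) / 4 * (n / d)) := by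
  have hn : 0 < n := NeZero.pos n
  have hle : ∀ d, d ∣ n → d % 4 ≠ 2 → (d + 2) / 4 * (n / d) ≤
      (n.divisors.filter (fun d => ¬ d ≡ 2 [MOD 4])).sup (fun d => (d + 2) / 4 * (n / d)) :=
    fun d h1 h2 => Finset.le_sup (f := fun d => (d + 2) / 4 * (n / d))
      (mem_filter.2 ⟨Nat.mem_divisors.2 ⟨h1, hn.ne'⟩, h2⟩)
  apply le_antisymm
  · rcases maxKLSumFree_bound n with h | ⟨q, hqn, hq3, h⟩
    · obtain ⟨d, h1, h2, h3⟩ := exists_dvd_div_four_le n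
      exact (show _ ≤ n / 4 by omega).trans (h3.trans (hle d h1 h2))
    · refine le_trans ?_ (hle q hqn (by omega))
      obtain ⟨m, hm⟩ := hqn
      rw [show n / q = m by rw [hm, Nat.mul_div_cancel_left m (by omega)]]
      have h4 : q + 1 = 4 * ((q + 2) / 4) := by omega
      refine le_of_mul_le_mul_left (a := 4 * q) ?_ (by omega)
      calc 4 * q * maxKLSumFree 3 1 (ZMod n) = 4 * (q * maxKLSumFree 3 1 (ZMod n)) := by ring
        _ ≤ (q + 1) * n := h
        _ = (4 * ((q + 2) / 4)) * (q * m) := by rw [← h4, ← hm]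
        _ = 4 * q * ((q + 2) / 4 * m) := by ring
  · refine Finset.sup_le fun d hd => ?_
    rw [mem_filter, Nat.mem_divisors] at hd
    exact le_maxKLSumFree hd.1.1 hd.2

theorem theorem6 (n : ℕ) [NeZero n] :
    maxKLSumFree 3 1 (ZMod n) =
        (n.divisors.filter (fun d => ¬ d ≡ 2 [MOD 4])).sup (fun d => (d + 2) / 4 * (n / d)) ∧
    (∀ p : ℕ, p.Prime → p ∣ n → p ≡ 3 [MOD 4] →
        (∀ q : ℕ, q.Prime → q ∣ n → q ≡ 3 [MOD 4] → p ≤ q) →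
        (maxKLSumFree 3 1 (ZMod n) : ℚ) = ((p : ℚ) + 1) / (p : ℚ) * ((n : ℚ) / 4)) ∧
    ((¬ ∃ p : ℕ, p.Prime ∧ p ∣ n ∧ p ≡ 3 [MOD 4]) →
        maxKLSumFree 3 1 (ZMod n) = n / 4) := by
  refine ⟨maxKLSumFree_eq_sup n, fun p hp hpn hp3 hmin => ?_, fun hno => ?_⟩
  · have hp3' : p % 4 = 3 := hp3
    have hp0 : (p : ℚ) ≠ 0 := by exact_mod_cast hp.ne_zero
    have hup : 4 * (p * maxKLSumFree 3 1 (ZMod n)) ≤ (p + 1) * n := by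
      rcases maxKLSumFree_bound n with h | ⟨q, hqn, hq3, h⟩
      · nlinarith
      · obtain ⟨r, hr, hrq, hr3⟩ := exists_prime_dvd_of_mod_four_eq_three hq3
        -- `(q + 1) / q` decreases in `q`, so the bound at `q` implies the one at `p`.
        have hpq : p ≤ q :=
          (hmin r hr (hrq.trans hqn) hr3).trans (Nat.le_of_dvd (by omega) hrq)
        refine le_of_mul_le_mul_left (a := q) ?_ (by omega)
        have h1 := Nat.mul_le_mul_left p h
        have h2 := Nat.mul_le_mul_right n hpq
        linarith
    have hlo : (p + 1) * n ≤ 4 * (p * maxKLSumFree 3 1 (ZMod n)) := by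
      have h1 := le_maxKLSumFree hpn (by omega)
      obtain ⟨m, hm⟩ := hpn
      rw [show n / p = m by rw [hm, Nat.mul_div_cancel_left m hp.pos]] at h1
      have h4 : p + 1 = 4 * ((p + 2) / 4) := by omega
      calc (p + 1) * n = 4 * (p * ((p + 2) / 4 * m)) := by
            rw [h4]; nth_rewrite 1 [hm]; ring
        _ ≤ _ := Nat.mul_le_mul_left 4 (Nat.mul_le_mul_left p h1)
    have heq : (4 * (p * maxKLSumFree 3 1 (ZMod n)) : ℚ) = (p + 1) * n := by
      exact_mod_cast le_antisymm hup hlo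
    field_simp
    linarith
  · apply le_antisymm
    · rcases maxKLSumFree_bound n with h | ⟨q, hqn, hq3, -⟩
      · omega
      · obtain ⟨r, hr, hrq, hr3⟩ := exists_prime_dvd_of_mod_four_eq_three hq3
        exact absurd ⟨r, hr, hrq.trans hqn, hr3⟩ hno
    · obtain ⟨d, h1, h2, h3⟩ := exists_dvd_div_four_le n
      exact h3.trans (le_maxKLSumFree h1 h2)
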